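/- **Definitions.** A relative positional encoding (RPE) is a set $R\subseteq\mathbb N\times\mathbb N$. For a finite token alphabet $\Gamma$, the formulas $\varphi$ and count-valued terms $t$ of C-RASP[$R$] are given by $$\varphi ::= Q_a\ (a\in\Gamma)\mid \neg\varphi\mid \varphi\wedge\varphi\mid t\le t,\qquad t ::= c\mid c\cdot t\mid t+t\mid \overleftarrow{\#}[\varphi]\mid \overleftarrow{\#}_R[\varphi]\qquad(c\in\mathbb Z).$$ They are evaluated at the positions $i\in\{1,\dots,|v|\}$ of a word $v\in\Gamma^*$: $Q_a$ holds at $i$ iff the $i$-th token of $v$ is $a$; the value of $\overleftarrow{\#}[\varphi]$ at $i$ is the number of $j\in\{1,\dots,i\}$ at which $\varphi$ holds; the value of $\overleftarrow{\#}_R[\varphi]$ at $i$ is the number of $j\in\{1,\dots,i\}$ with $(i,j)\in R$ at which $\varphi$ holds; the remaining constructs have their usual meaning. On the empty word, formulas are evaluated with all counts equal to $0$ and all $Q_a$ false. A CoT C-RASP[$R$] over $\Gamma$ is a finite ordered list of rules $O_{a}\leftarrow\varphi$ (with $a\in\Gamma$ and $\varphi$ a formula) together with a set $F\subseteq\Gamma$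 of accepting tokens. On a token sequence $v$ it outputs the token $a$ of the first rule $O_a\leftarrow\varphi$ in the list whose formula $\varphi$ holds at the last position of $v$, and the chain of thought continues with $va$; if no rule applies, the chain of thought ends. For an input alphabet $\Sigma\subseteq\Gamma$, the CoT C-RASP[$R$] recognizes $L\subseteq\Sigma^*$ if for every $w\in\Sigma^*$: the chain of thought started from $w$ outputs a token of $F$ at some step if and only if $w\in L$. **Theorem.** CoT C-RASP[RPEs] is Turing-complete over arbitrary alphabets, already with one fixed RPE that depends neither on the alphabet nor on the language: let $$R=\{(i,j)\in\mathbb N\times\mathbb N : \text{the digit of weight } 2^j \text{ in the binary expansion of } i \text{ is } 1\}.$$ Then for every finite alphabet $\Sigma$ and every recursively enumerable language $L\subseteq\Sigma^*$ there are a finite token alphabet $\Gamma\supseteq\Sigma$ and a CoT C-RASP[$R$] over $\Gamma$ that recognizes $L$. -/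

import Mathlib

namespace CRASP

universe u

/-- A relative positional encoding: a set of pairs `(i, j)`, where `i` is the current position
and `j ≤ i` is a position that is looked at. -/
abbrev RPE := Set (ℕ × ℕ)

mutual

/-- Boolean-valued C-RASP[RPEs] expressions over the token alphabet `Γ`. -/
inductive Formula (Γ : Type u) where
  /-- `Q_a`: the current position carries the token `a`. -/
  | letter (a : Γ) : Formula Γ
  | neg (φ : Formula Γ) : Formula Γ
  | and (φ ψ : Formula Γ) : Formula Γ
  /-- comparison `s ≤ t` of two count-valued expressions. -/
  | le (s t : CountTerm Γ) : Formula Γ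

/-- Count-valued C-RASP[RPEs] expressions: integer linear combinations of counts. -/
inductive CountTerm (Γ : Type u) where
  | const (c : ℤ) : CountTerm Γ
  | smul (c : ℤ) (t : CountTerm Γ) : CountTerm Γ
  | add (s t : CountTerm Γ) : CountTerm Γ
  /-- the number of positions `j ≤ i` that satisfy `φ`, where `i` is the current position. -/
  | count (φ : Formula Γ) : CountTerm Γ
  /-- the number of positions `j ≤ i` with `(i, j) ∈ R` that satisfy `φ`,
  where `i` is the current position and `R` is the relative positional encoding. -/
  | countRPE (φ : Formula Γ) : CountTerm Γ

end

open Classical in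
mutual

/-- Truth of a formula on the token sequence `v` at position `i`. Positions are `1, …, |v|`.
On the empty sequence formulas are evaluated at `i = 0`, where no letter predicate holds and
every count is zero. -/
noncomputable def Formula.Holds {Γ : Type*} (R : RPE) (v : List Γ) :
    Formula Γ → ℕ → Prop
  | .letter a, i => 1 ≤ i ∧ v[i - 1]? = some a
  | .neg φ, i => ¬ φ.Holds R v i
  | .and φ ψ, i => φ.Holds R v i ∧ ψ.Holds R v i
  | .le s t, i => s.val R v i ≤ t.val R v i

/-- Value of a count-valued expression on the token sequence `v` at position `i`. -/
noncomputable def CountTerm.val {Γ : Type*} (R : RPE) (v : List Γ) :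
    CountTerm Γ → ℕ → ℤ
  | .const c, _ => c
  | .smul c t, i => c * t.val R v i
  | .add s t, i => s.val R v i + t.val R v i
  | .count φ, i => (((Finset.Icc 1 i).filter fun j => φ.Holds R v j).card : ℤ)
  | .countRPE φ, i =>
      (((Finset.Icc 1 i).filter fun j => (i, j) ∈ R ∧ φ.Holds R v j).card : ℤ)

end

/-- A CoT C-RASP[RPEs] over the token alphabet `Γ`: an ordered finite list of output rules
`O_a ← φ`, together with a set of accepting tokens. -/
structure CoT (Γ : Type*) where
  rules : List (Γ × Formula Γ)
  accept : Set Γ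

open Classical in
/-- The token that is output after the token sequence `v`: the token of the first rule whose
formula holds at the last position of `v`. If there is no such rule, nothing is output. -/
noncomputable def CoT.next {Γ : Type*} (P : CoT Γ) (R : RPE) (v : List Γ) : Option Γ :=
  (P.rules.find? fun r => decide (r.2.Holds R v v.length)).map Prod.fst

/-- The token sequence after `n` chain-of-thought steps from `v`, each of which appends the
output token to the sequence; `none` if the chain of thought ends earlier. -/
noncomputable def CoT.run {Γ : Type*} (P : CoT Γ) (R : RPE) (v : List Γ) : ℕ → Option (List Γ)
  | 0 => some v
  | n + 1 => (P.run R v n).bind fun u => (P.next R u).map fun a => u ++ [a]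

/-- A start sequence is accepted if an accepting token is output at some step. -/
def CoT.Accepts {Γ : Type*} (P : CoT Γ) (R : RPE) (v : List Γ) : Prop :=
  ∃ (n : ℕ) (u : List Γ) (a : Γ), P.run R v n = some u ∧ P.next R u = some a ∧ a ∈ P.accept

/-- `P` recognizes the language `L` over the input alphabet `α`, which is contained in the
token alphabet `Γ` via `emb`. -/
def CoT.Recognizes {α Γ : Type*} (P : CoT Γ) (R : RPE) (emb : α ↪ Γ) (L : Language α) : Prop :=
  ∀ w : List α, P.Accepts R (w.map emb) ↔ w ∈ L

/-- The relative positional encoding that consists of the pairs `(i, j)` for which the digit of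
weight `2 ^ j` in the binary expansion of `i` is one. -/
def bitRPE : RPE := {p | p.1.testBit p.2 = true}

end CRASP

/-! ### While programs over natural number registers -/

namespace WhileProgram

open Function

-- The difficulty is to read the input: plain counts do not see the order of tokens. The encoding
-- `bitRPE` supplies it, because at position `i` a formula can compare the set of binary digits of
-- `i` with the set of positions that carry a given letter. After the input `w` the chain outputs a
-- mark at position `|w| + 1` and then pads. For each letter `a` there is a number `mask a w` whose
-- digits record the occurrences of `a`, closed off by a leading digit that belongs to the mark.
-- Three equations between counts express `i / 2 = mask a w` (`holds_meetsMask`); the digit of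
-- weight one stays free, since there is no position `0`. The number of positions before this first
-- happens is `2 * mask a w - 1`, and it is a count that never changes afterwards (`val_inputTerm`).
-- So the word becomes a tuple of numbers, and this tuple determines the word (`code_injective`).
--
-- Running a counter machine on these numbers is then linear arithmetic. If the chain outputs the
-- states that the machine visits, each counter is its initial value plus a fixed integer
-- combination of the numbers of visits to the states, hence a term, and its sign decides the next
-- state (`simulation_accepts_iff`).
--
-- It remains to find a counter machine for the language. An r.e. predicate of the tuple is an
-- unbounded search for a zero of a primitive recursive function (`exists_primrec'_of_rePred`); such
-- functions are computed by while programs (`exists_prog`), and a while program is a counter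
-- machine whose states are the finitely many stacks of pending subprograms
-- (`exists_counterMachine`).

/-- While programs acting on registers that are indexed by `ℕ` and hold natural numbers. -/
inductive Prog where
  | skip : Prog
  | inc (r : ℕ) : Prog
  | dec (r : ℕ) : Prog
  | seq (P Q : Prog) : Prog
  /-- `while r ≠ 0 do P`. -/
  | loop (r : ℕ) (P : Prog) : Prog

/-- Big-step semantics: `Run P s s'` says that `P` terminates on the registers `s` and leaves the
registers `s'`. A register that holds zero cannot be decremented. -/
inductive Run : Prog → (ℕ → ℕ) → (ℕ → ℕ) → Prop
  | skip (s : ℕ → ℕ) : Run .skip s s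
  | inc (r : ℕ) (s : ℕ → ℕ) : Run (.inc r) s (update s r (s r + 1))
  | dec (r : ℕ) (s : ℕ → ℕ) (h : s r ≠ 0) : Run (.dec r) s (update s r (s r - 1))
  | seq {P Q : Prog} {s s' s'' : ℕ → ℕ} : Run P s s' → Run Q s' s'' → Run (.seq P Q) s s''
  | loop_done {r : ℕ} {P : Prog} {s : ℕ → ℕ} : s r = 0 → Run (.loop r P) s s
  | loop_step {r : ℕ} {P : Prog} {s s' s'' : ℕ → ℕ} :
      s r ≠ 0 → Run P s s' → Run (.loop r P) s' s'' → Run (.loop r P) s s''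

theorem Run.of_eq {P : Prog} {s t t' : ℕ → ℕ} (h : Run P s t) (e : t = t') : Run P s t' := e ▸ h

/-- A loop whose body decrements the loop register. -/
theorem Run.loop_countdown {r : ℕ} {P : Prog} (F : ℕ → ℕ → ℕ) (hr : ∀ j, F j r = j) (n : ℕ)
    (hP : ∀ j < n, Run P (F (j + 1)) (F j)) : Run (.loop r P) (F n) (F 0) := by
  induction n with
  | zero => exact .loop_done (hr 0)
  | succ n ih =>
    exact .loop_step (by simp [hr]) (hP n (by omega)) (ih fun j hj => hP j (by omega))

/-- Set a register to zero. -/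
def Prog.clear (r : ℕ) : Prog := .loop r (.dec r)

theorem Run.clear (r : ℕ) (s : ℕ → ℕ) : Run (.clear r) s (update s r 0) := by
  have := Run.loop_countdown (r := r) (P := .dec r) (fun j => update s r j) (by simp) (s r)
    fun j _ => (Run.dec r _ (by simp)).of_eq (by simp)
  simpa [Prog.clear] using this

/-- Add a register to another one and set it to zero. -/
def Prog.move (src dst : ℕ) : Prog := .loop src (.seq (.dec src) (.inc dst))

theorem Run.move {src dst : ℕ} (h : src ≠ dst) (s : ℕ → ℕ) :
    Run (.move src dst) s (update (update s src 0) dst (s dst + s src)) := by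
  have := Run.loop_countdown (r := src) (P := .seq (.dec src) (.inc dst))
    (fun j => update (update s src j) dst (s dst + (s src - j))) (by simp [h]) (s src) ?_
  · simpa [Prog.move] using this
  · intro j hj
    refine .seq (.dec _ _ (by simp [h])) ((Run.inc _ _).of_eq ?_)
    funext r
    simp only [update_apply]
    split_ifs <;> omega

/-- Add a register to another one by means of a scratch register. -/
def Prog.copy (src dst tmp : ℕ) : Prog :=
  .seq (.loop src (.seq (.dec src) (.seq (.inc dst) (.inc tmp)))) (.move tmp src)

theorem Run.copy {src dst tmp : ℕ} (h₁ : src ≠ dst) (h₂ : src ≠ tmp) (h₃ : dst ≠ tmp) (s : ℕ → ℕ)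
    (h : s tmp = 0) : Run (.copy src dst tmp) s (update s dst (s dst + s src)) := by
  have := Run.loop_countdown (r := src) (P := .seq (.dec src) (.seq (.inc dst) (.inc tmp)))
    (fun j => update (update (update s src j) dst (s dst + (s src - j))) tmp (s src - j))
    (by simp [h₁, h₂]) (s src) ?_
  · simp only [update_eq_self, Nat.sub_self, Nat.add_zero, Nat.sub_zero] at this
    rw [← h, update_eq_self] at this
    refine .seq this ((Run.move h₂.symm _).of_eq ?_)
    funext r
    simp only [update_apply]
    split_ifs <;> simp_all
  · intro j hj
    refine .seq (.dec _ _ (by simp [h₁, h₂])) (.seq (.inc _ _) ((Run.inc _ _).of_eq ?_))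
    funext r
    simp only [update_apply]
    split_ifs <;> omega

/-- For functions `g 0, …, g (m - 1)` with programs that store their values in the registers
`b, …, b + m - 1`, a program that runs all of them. -/
theorem exists_prog_tuple (b : ℕ) (m : ℕ) (G : ℕ → (ℕ → ℕ) → ℕ)
    (hG : ∀ i < m, ∀ s s' : ℕ → ℕ, (∀ r < b, s r = s' r) → G i s = G i s')
    (h : ∀ i < m, ∃ P, ∀ s : ℕ → ℕ, (∀ r ≥ b + i, s r = 0) → Run P s (update s (b + i) (G i s))) :
    ∃ P, ∀ s : ℕ → ℕ, (∀ r ≥ b, s r = 0) →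
      Run P s fun r => if b ≤ r ∧ r < b + m then G (r - b) s else s r := by
  induction m with
  | zero =>
    refine ⟨.skip, fun s _ => (Run.skip s).of_eq ?_⟩
    funext r
    rw [if_neg (by omega)]
  | succ m ih =>
    obtain ⟨P, hP⟩ := ih (fun i hi => hG i (by omega)) (fun i hi => h i (by omega))
    obtain ⟨Q, hQ⟩ := h m (by omega)
    refine ⟨.seq P Q, fun s hs => .seq (hP s hs) ((hQ _ ?_).of_eq ?_)⟩
    · intro r hr
      rw [if_neg (by omega)]
      exact hs r (by omega)
    · funext r
      rw [update_apply]
      by_cases hr : r = b + m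
      · subst hr
        rw [if_pos rfl, if_pos (by omega), Nat.add_sub_cancel_left]
        exact hG m (by omega) _ _ fun r hr => if_neg (by omega)
      · rw [if_neg hr]
        exact if_congr (by omega) rfl rfl

/-- Set the registers `b, …, b + m - 1` to zero. -/
theorem exists_prog_clear (b m : ℕ) :
    ∃ P, ∀ s : ℕ → ℕ, Run P s fun r => if b ≤ r ∧ r < b + m then 0 else s r := by
  induction m with
  | zero =>
    refine ⟨.skip, fun s => (Run.skip s).of_eq ?_⟩
    funext r
    rw [if_neg (by omega)]
  | succ m ih =>
    obtain ⟨P, hP⟩ := ih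
    refine ⟨.seq P (.clear (b + m)), fun s => .seq (hP s) ((Run.clear _ _).of_eq ?_)⟩
    funext r
    simp only [update_apply]
    split_ifs <;> first | rfl | omega

-- Compiling primitive recursive functions into while programs

/-- Every primitive recursive function is computed by a while program, for an arbitrary choice of
input registers, output register, and scratch registers. -/
theorem exists_prog {n : ℕ} {f : List.Vector ℕ n → ℕ} (hf : Nat.Primrec' f) :
    ∀ (inp : Fin n → ℕ) (out b : ℕ), (∀ i, inp i < b) → out < b → (∀ i, inp i ≠ out) →
      ∃ P : Prog, ∀ s : ℕ → ℕ, (∀ r ≥ b, s r = 0) → s out = 0 →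
        Run P s (update s out (f (List.Vector.ofFn fun i => s (inp i)))) := by
  induction hf with
  | zero =>
    intro inp out b _ _ _
    exact ⟨.skip, fun s _ h0 => (Run.skip s).of_eq (by simp [← h0])⟩
  | succ =>
    intro inp out b hi ho hio
    have := hi 0
    refine ⟨.seq (.copy (inp 0) out b) (.inc out), fun s hs h0 => ?_⟩
    refine .seq (Run.copy (hio 0) (by omega) (by omega) s (hs b le_rfl)) ((Run.inc _ _).of_eq ?_)
    simp [h0]
  | get i =>
    intro inp out b hi ho hio
    have := hi i
    refine ⟨.copy (inp i) out b, fun s hs h0 => ?_⟩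
    refine (Run.copy (hio i) (by omega) (by omega) s (hs b le_rfl)).of_eq ?_
    simp [h0]
  | @comp m n f g _ _ ihf ihg =>
    intro inp out b hi ho hio
    -- The values of the inner functions go to `b, …, b + n - 1`. The scratch area of the `i`-th one
    -- starts at `b + i + 1`, beyond the values already stored.
    obtain ⟨P, hP⟩ := exists_prog_tuple b n
      (fun i s => if h : i < n then g ⟨i, h⟩ (List.Vector.ofFn fun j => s (inp j)) else 0)
      (fun i hin s s' h => by simp only [h _ (hi _)])
      (fun i hin => by
        obtain ⟨P, hP⟩ := ihg ⟨i, hin⟩ inp (b + i) (b + i + 1)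
          (fun j => by have := hi j; omega) (by omega) (fun j => by have := hi j; omega)
        refine ⟨P, fun s hs => ?_⟩
        simpa [hin] using hP s (fun r hr => hs r (by omega)) (hs _ le_rfl))
    obtain ⟨Q, hQ⟩ := ihf (fun i => b + i) out (b + n) (fun i => by omega) (by omega)
      (fun i => by omega)
    -- The specification changes no register but `out`, so all scratch registers must be returned as
    -- zero.
    obtain ⟨C, hC⟩ := exists_prog_clear b n
    refine ⟨.seq P (.seq Q C), fun s hs h0 => .seq (hP s hs) (.seq (hQ _ ?_ ?_) ((hC _).of_eq ?_))⟩
    · intro r hr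
      rw [if_neg (by omega)]
      exact hs r (by omega)
    · rw [if_neg (by omega), h0]
    · have e : (List.Vector.ofFn fun i : Fin n => if b ≤ b + (i : ℕ) ∧ b + (i : ℕ) < b + n then
          (if h : b + (i : ℕ) - b < n then
            g ⟨b + (i : ℕ) - b, h⟩ (List.Vector.ofFn fun j => s (inp j)) else 0)
          else s (b + i)) =
          List.Vector.ofFn fun i => g i (List.Vector.ofFn fun j => s (inp j)) := by
        congr 1
        funext i
        simp
      funext r
      rw [e]
      simp only [update_apply]
      split_ifs with h1 h2
      · omega
      · exact (hs r h1.1).symm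
      · rfl
      · rfl
  | @prec n f g _ _ ihf ihg =>
    intro inp out b hi ho hio
    -- `b` counts down, `b + 1` counts up, `b + 2` holds the current value, `b + 3` the next one.
    obtain ⟨P, hP⟩ := ihf (fun i => inp i.succ) (b + 2) (b + 4)
      (fun i => by have := hi i.succ; omega) (by omega) (fun i => by have := hi i.succ; omega)
    obtain ⟨Q, hQ⟩ := ihg (Fin.cons (b + 1) (Fin.cons (b + 2) fun i => inp i.succ)) (b + 3) (b + 4)
      (by
        refine Fin.cases ?_ (Fin.cases ?_ fun i => ?_)
        · simp
        · simp
        · have := hi i.succ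
          simp only [Fin.cons_succ]
          omega)
      (by omega)
      (by
        refine Fin.cases ?_ (Fin.cases ?_ fun i => ?_)
        · simp
        · simp
        · have := hi i.succ
          simp only [Fin.cons_succ]
          omega)
    -- `b + 1` first serves as scratch for the copy, which hands it back as zero, the start of the
    -- upward count.
    refine ⟨.seq P (.seq (.copy (inp 0) b (b + 1)) (.seq
      (.loop b (.seq (.dec b) (.seq Q (.seq (.clear (b + 2)) (.seq (.move (b + 3) (b + 2))
        (.inc (b + 1))))))) (.seq (.clear (b + 1)) (.move (b + 2) out)))), fun s hs h0 => ?_⟩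
    have hi0 := hi 0
    set N := s (inp 0) with hN
    set v := List.Vector.ofFn fun i => s (inp i.succ) with hv
    let rec' : ℕ → ℕ := fun k => Nat.rec (f v) (fun y IH => g (y ::ᵥ IH ::ᵥ v)) k
    -- Loop invariant: the registers when `j` rounds remain.
    let F : ℕ → ℕ → ℕ := fun j => update (update (update s b j) (b + 1) (N - j)) (b + 2)
      (rec' (N - j))
    have hloop := Run.loop_countdown (r := b) (P := (.seq (.dec b) (.seq Q (.seq (.clear (b + 2))
      (.seq (.move (b + 3) (b + 2)) (.inc (b + 1))))))) F (by simp [F]) N ?_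
    · refine .seq (hP s (fun r hr => hs r (by omega)) (hs _ (by omega))) (.seq ((Run.copy
        (by omega) (by omega) (by omega) _ ?_).of_eq (t' := F N) ?_) (.seq hloop
          (.seq (Run.clear _ _) ((Run.move (by omega) _).of_eq ?_))))
      · simp only [update_apply]
        rw [if_neg (by omega), hs _ (by omega)]
      · have hb := hs b (by omega)
        have hb1 := hs (b + 1) (by omega)
        funext r
        simp only [update_apply, F, Nat.sub_self]
        split_ifs <;> first | rfl | omega | (subst_vars; simp_all)
      · have e : (List.Vector.ofFn fun i => s (inp i)) = N ::ᵥ v := rfl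
        have hb := hs b (by omega)
        have hb1 := hs (b + 1) (by omega)
        have hb2 := hs (b + 2) (by omega)
        funext r
        rw [e]
        simp only [update_apply, F, Nat.sub_zero, List.Vector.head_cons, List.Vector.tail_cons]
        split_ifs <;> first | omega | (subst_vars; simp_all [rec'])
    · intro j hj
      refine .seq (.dec _ _ (by simp [F])) (.seq (hQ _ ?_ ?_) (.seq (Run.clear _ _)
        (.seq (Run.move (by omega) _) ((Run.inc _ _).of_eq ?_))))
      · intro r hr
        simp only [update_apply, F]
        rw [if_neg (by omega), if_neg (by omega), if_neg (by omega), if_neg (by omega),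
          hs r (by omega)]
      · simp only [update_apply, F]
        rw [if_neg (by omega), if_neg (by omega), if_neg (by omega), if_neg (by omega),
          hs _ (by omega)]
      · have hb3 := hs (b + 3) (by omega)
        have e : (List.Vector.ofFn fun i => update (F (j + 1)) b (F (j + 1) b - 1)
            ((Fin.cons (b + 1) (Fin.cons (b + 2) fun i => inp i.succ) : Fin (n + 2) → ℕ) i)) =
            (N - (j + 1)) ::ᵥ rec' (N - (j + 1)) ::ᵥ v := by
          have hv' : (List.Vector.ofFn fun i : Fin n =>
              update (F (j + 1)) b (F (j + 1) b - 1) (inp i.succ)) = v := by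
            rw [hv]
            congr 1
            funext i
            have := hi i.succ
            simp only [update_apply, F]
            rw [if_neg (by omega), if_neg (by omega), if_neg (by omega), if_neg (by omega)]
          rw [← hv']
          simp [List.Vector.ofFn, F]
        have e2 : rec' (N - j) = g ((N - (j + 1)) ::ᵥ rec' (N - (j + 1)) ::ᵥ v) := by
          have : N - j = (N - (j + 1)) + 1 := by omega
          rw [this]
        have hX1 : update (F (j + 1)) b (F (j + 1) b - 1) (b + 1) + 1 = N - j := by
          simp only [F, update_apply]
          split_ifs <;> omega
        have hX3 : update (F (j + 1)) b (F (j + 1) b - 1) (b + 3) = 0 := by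
          simp [F, hb3]
        have hX : F j = update (update (update (F (j + 1)) b (F (j + 1) b - 1)) (b + 1) (N - j))
            (b + 2) (rec' (N - j)) := by
          funext r
          simp only [F, update_apply]
          split_ifs <;> first | rfl | omega
        rw [e, ← e2, hX, ← hX1]
        generalize update (F (j + 1)) b (F (j + 1) b - 1) = X at hX3 ⊢
        have h12 : b + 1 ≠ b + 2 := by omega
        have h13 : b + 1 ≠ b + 3 := by omega
        have h23 : b + 2 ≠ b + 3 := by omega
        funext r
        rcases eq_or_ne r (b + 1) with rfl | h1
        · simp
        rcases eq_or_ne r (b + 2) with rfl | h2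
        · simp
        rcases eq_or_ne r (b + 3) with rfl | h3
        · simp [hX3]
        · simp [h1, h2, h3]

end WhileProgram

/-! ### Counter machines -/

/-- Counter machines whose integer counters are indexed by `ℕ`. In the state `q`, first `effect q`
is added to the counters, and then the next state depends on whether the counter `test q` is
positive. -/
structure CounterMachine (Q : Type*) where
  effect : Q → ℕ → ℤ
  test : Q → ℕ
  onZero : Q → Q
  onPos : Q → Q

namespace CounterMachine

variable {Q : Type*}

/-- One step of a counter machine on a state and the values of the counters. -/
def step (M : CounterMachine Q) (x : Q × (ℕ → ℤ)) : Q × (ℕ → ℤ) :=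
  (if (x.2 + M.effect x.1) (M.test x.1) ≤ 0 then M.onZero x.1 else M.onPos x.1,
    x.2 + M.effect x.1)

/-- A counter machine restricted to a set of states that is closed under transitions. -/
def restrict (M : CounterMachine Q) (C : Set Q) (h₀ : ∀ q ∈ C, M.onZero q ∈ C)
    (h₁ : ∀ q ∈ C, M.onPos q ∈ C) : CounterMachine C where
  effect q := M.effect q
  test q := M.test q
  onZero q := ⟨M.onZero q, h₀ q q.2⟩
  onPos q := ⟨M.onPos q, h₁ q q.2⟩

theorem restrict_step_iterate (M : CounterMachine Q) (C : Set Q) (h₀ : ∀ q ∈ C, M.onZero q ∈ C)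
    (h₁ : ∀ q ∈ C, M.onPos q ∈ C) (t : ℕ) (x : C × (ℕ → ℤ)) :
    Prod.map Subtype.val id ((M.restrict C h₀ h₁).step^[t] x) =
      M.step^[t] (Prod.map Subtype.val id x) := by
  refine Function.Semiconj.iterate_right (f := Prod.map Subtype.val id) (fun y => ?_) t x
  exact Prod.ext (apply_ite Subtype.val _ _ _) rfl

/-- The initial counter values for the inputs `x`. -/
def initial {k : ℕ} (x : Fin k → ℕ) (r : ℕ) : ℕ := if h : r < k then x ⟨r, h⟩ else 0

end CounterMachine

-- Running while programs on counter machines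

namespace WhileProgram

open Function

/-- The counter machine that runs while programs. Its states are the stacks of programs that remain
to be run. -/
def machine : CounterMachine (List Prog) where
  effect
    | .inc r :: _ => Pi.single r 1
    | .dec r :: _ => Pi.single r (-1)
    | _ => 0
  test
    | .loop r _ :: _ => r
    | _ => 0
  onZero
    | [] => []
    | .seq P Q :: K => P :: Q :: K
    | _ :: K => K
  onPos
    | [] => []
    | .seq P Q :: K => P :: Q :: K
    | .loop r P :: K => P :: .loop r P :: K
    | _ :: K => K

/-- The stacks that occur while `P` is run on top of the stack `K`. -/
def conts : Prog → List Prog → Set (List Prog)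
  | .seq P Q, K => {.seq P Q :: K} ∪ (conts P (Q :: K) ∪ conts Q K)
  | .loop r P, K => {.loop r P :: K} ∪ conts P (.loop r P :: K)
  | P, K => {P :: K}

theorem conts_finite (P : Prog) (K : List Prog) : (conts P K).Finite := by
  induction P generalizing K with
  | skip => exact Set.finite_singleton _
  | inc r => exact Set.finite_singleton _
  | dec r => exact Set.finite_singleton _
  | seq P Q ihP ihQ => exact (Set.finite_singleton _).union ((ihP _).union (ihQ _))
  | loop r P ih => exact (Set.finite_singleton _).union (ih _)

theorem cons_mem_conts (P : Prog) (K : List Prog) : P :: K ∈ conts P K := by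
  cases P <;> simp [conts]

/-- Control leaves the set only through the stack `K` below `P`. For a subprogram, that exit stack
is again one of the stacks of the surrounding program, or its exit. -/
theorem conts_closed (P : Prog) (K c : List Prog) (hc : c ∈ conts P K) :
    (machine.onZero c ∈ conts P K ∨ machine.onZero c = K) ∧
      (machine.onPos c ∈ conts P K ∨ machine.onPos c = K) := by
  induction P generalizing K with
  | skip => obtain rfl : c = _ := hc; exact ⟨.inr rfl, .inr rfl⟩
  | inc r => obtain rfl : c = _ := hc; exact ⟨.inr rfl, .inr rfl⟩
  | dec r => obtain rfl : c = _ := hc; exact ⟨.inr rfl, .inr rfl⟩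
  | seq P Q ihP ihQ =>
    have hP := cons_mem_conts P (Q :: K)
    have hQ := cons_mem_conts Q K
    rcases hc with rfl | hc | hc
    · exact ⟨.inl (.inr (.inl hP)), .inl (.inr (.inl hP))⟩
    · obtain ⟨h₀, h₁⟩ := ihP _ hc
      exact ⟨.inl (.inr (h₀.imp id fun h => by rwa [h])), .inl (.inr (h₁.imp id fun h => by rwa [h]))⟩
    · obtain ⟨h₀, h₁⟩ := ihQ _ hc
      exact ⟨h₀.imp (fun h => .inr (.inr h)) id, h₁.imp (fun h => .inr (.inr h)) id⟩
  | loop r P ih =>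
    rcases hc with rfl | hc
    · exact ⟨.inr rfl, .inl (.inr (cons_mem_conts P _))⟩
    · obtain ⟨h₀, h₁⟩ := ih _ hc
      exact ⟨.inl (h₀.symm.imp id id), .inl (h₁.symm.imp id id)⟩

/-- The machine runs programs on top of an arbitrary stack. -/
theorem Run.machine {P : Prog} {s s' : ℕ → ℕ} (h : Run P s s') (K : List Prog) :
    ∃ t > 0, machine.step^[t] (P :: K, fun r => (s r : ℤ)) = (K, fun r => (s' r : ℤ)) := by
  induction h generalizing K with
  | skip s => exact ⟨1, one_pos, by simp [CounterMachine.step, WhileProgram.machine]⟩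
  | inc r s =>
    refine ⟨1, one_pos, Prod.ext (by simp [CounterMachine.step, WhileProgram.machine]) ?_⟩
    funext r'
    rcases eq_or_ne r' r with rfl | h <;>
      simp [CounterMachine.step, WhileProgram.machine, *]
  | dec r s h =>
    refine ⟨1, one_pos, Prod.ext (by simp [CounterMachine.step, WhileProgram.machine]) ?_⟩
    funext r'
    rcases eq_or_ne r' r with rfl | h'
    · simp [CounterMachine.step, WhileProgram.machine]
      omega
    · simp [CounterMachine.step, WhileProgram.machine, *]
  | @seq P Q s s' s'' _ _ ihP ihQ =>
    obtain ⟨t₁, _, h₁⟩ := ihP (Q :: K)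
    obtain ⟨t₂, _, h₂⟩ := ihQ K
    refine ⟨t₂ + (t₁ + 1), by omega, ?_⟩
    rw [iterate_add_apply, iterate_succ_apply, ← h₂, ← h₁]
    simp [CounterMachine.step, WhileProgram.machine]
  | loop_done h => exact ⟨1, one_pos, by simp [CounterMachine.step, WhileProgram.machine, h]⟩
  | @loop_step r P s s' s'' h _ _ ih₁ ih₂ =>
    obtain ⟨t₁, _, h₁⟩ := ih₁ (.loop r P :: K)
    obtain ⟨t₂, _, h₂⟩ := ih₂ K
    refine ⟨t₂ + (t₁ + 1), by omega, ?_⟩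
    rw [iterate_add_apply, iterate_succ_apply, ← h₂, ← h₁]
    simp [CounterMachine.step, WhileProgram.machine, h]

theorem machine_step_iterate_nil (t : ℕ) (x : List Prog × (ℕ → ℤ)) (hx : x.1 = []) :
    (machine.step^[t] x).1 = [] := by
  obtain ⟨_, c⟩ := x
  subst hx
  have h : machine.step ([], c) = ([], c) := by simp [CounterMachine.step, machine]
  rw [iterate_fixed h]

open CounterMachine in
/-- Every unbounded search for a zero of a primitive recursive function is carried out by a counter
machine with finitely many states. -/
theorem exists_counterMachine {k : ℕ} {f : List.Vector ℕ (k + 1) → ℕ} (hf : Nat.Primrec' f) :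
    ∃ (Q : Type) (_ : Finite Q) (M : CounterMachine Q) (start halt : Q), ∀ x : Fin k → ℕ,
      (∃ t, (M.step^[t] (start, fun r => (initial x r : ℤ))).1 = halt) ↔
        ∃ m, f (m ::ᵥ List.Vector.ofFn x) = 0 := by
  -- Registers below `k` hold the input, `k` the candidate `m`, `k + 1` the value of `f`; scratch
  -- starts at `k + 2`.
  obtain ⟨P, hP⟩ := exists_prog hf (Fin.cons k fun i => i) (k + 1) (k + 2)
    (Fin.cases (by simp) fun i => by simp only [Fin.cons_succ]; omega) (by omega)
    (Fin.cases (by simp) fun i => by simp only [Fin.cons_succ]; omega)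
  let B : Prog := .seq (.clear (k + 1)) (.seq (.inc k) P)
  let main : Prog := .seq P (.loop (k + 1) B)
  let C : Set (List Prog) := conts main [] ∪ {[]}
  have h₀ : ∀ q ∈ C, machine.onZero q ∈ C := by
    rintro q (hq | rfl)
    · exact (conts_closed _ _ _ hq).1
    · exact .inr rfl
  have h₁ : ∀ q ∈ C, machine.onPos q ∈ C := by
    rintro q (hq | rfl)
    · exact (conts_closed _ _ _ hq).2
    · exact .inr rfl
  refine ⟨C, ((conts_finite main []).union (Set.finite_singleton _)).to_subtype,
    machine.restrict C h₀ h₁, ⟨[main], .inl (cons_mem_conts _ _)⟩, ⟨[], .inr rfl⟩, fun x => ?_⟩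
  have hred : ∀ t, ((machine.restrict C h₀ h₁).step^[t]
      (⟨[main], .inl (cons_mem_conts _ _)⟩, fun r => (initial x r : ℤ))).1 = ⟨[], .inr rfl⟩ ↔
      (machine.step^[t] ([main], fun r => (initial x r : ℤ))).1 = [] := by
    intro t
    rw [Subtype.ext_iff]
    have := congrArg Prod.fst (restrict_step_iterate machine C h₀ h₁ t
      (⟨[main], .inl (cons_mem_conts _ _)⟩, fun r => (initial x r : ℤ)))
    simpa using Eq.congr_left this
  simp only [hred]
  let g : ℕ → ℕ := fun m => f (m ::ᵥ List.Vector.ofFn x)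
  let s : ℕ → ℕ → ℕ := fun m => update (update (initial x) k m) (k + 1) (g m)
  have hrun : ∀ m, Run P (update (initial x) k m) (s m) := by
    intro m
    refine (hP _ ?_ ?_).of_eq ?_
    · intro r hr
      have h1 : r ≠ k := by omega
      have h2 : ¬ r < k := by omega
      simp [initial, h1, h2]
    · simp [initial]
    · have : (List.Vector.ofFn fun i => update (initial x) k m
          ((Fin.cons k fun i : Fin k => (i : ℕ) : Fin (k + 1) → ℕ) i)) =
          m ::ᵥ List.Vector.ofFn x := by
        have : (List.Vector.ofFn fun i : Fin k => update (initial x) k m i) =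
            List.Vector.ofFn x := by
          congr 1
          funext i
          simp [initial, i.2.ne]
        rw [← this]
        simp [List.Vector.ofFn]
      rw [this]
  have hstart : ∃ t, machine.step^[t] ([main], fun r => (initial x r : ℤ)) =
      ([.loop (k + 1) B], fun r => (s 0 r : ℤ)) := by
    have h : Run P (initial x) (s 0) := by
      have : initial x = update (initial x) k 0 := by simp [initial]
      rw [this]
      exact hrun 0
    obtain ⟨t, _, ht⟩ := h.machine [.loop (k + 1) B]
    refine ⟨t + 1, ?_⟩
    rw [iterate_succ_apply, ← ht]
    simp [CounterMachine.step, machine, main]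
  have hnext : ∀ m, g m ≠ 0 → ∃ t > 0,
      machine.step^[t] ([.loop (k + 1) B], fun r => (s m r : ℤ)) =
        ([.loop (k + 1) B], fun r => (s (m + 1) r : ℤ)) := by
    intro m hm
    have h : Run B (s m) (s (m + 1)) := by
      refine .seq (Run.clear _ _) (.seq (Run.inc _ _) ?_)
      convert hrun (m + 1) using 1
      funext r
      rcases eq_or_ne r k with rfl | h1
      · simp [s]
      rcases eq_or_ne r (k + 1) with rfl | h2
      · simp [initial]
      · simp [s, h1, h2]
    obtain ⟨t, _, ht⟩ := h.machine [.loop (k + 1) B]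
    refine ⟨t + 1, by omega, ?_⟩
    rw [iterate_succ_apply, ← ht]
    simp [CounterMachine.step, machine, s, hm]
  -- The bound `t ≥ m` makes a failing search visit the loop head at arbitrarily late times, which
  -- is incompatible with the absorbing empty stack.
  have hreach : ∀ m, (∀ j < m, g j ≠ 0) → ∃ t ≥ m,
      machine.step^[t] ([main], fun r => (initial x r : ℤ)) =
        ([.loop (k + 1) B], fun r => (s m r : ℤ)) := by
    intro m
    induction m with
    | zero => exact fun _ => hstart.imp fun t ht => ⟨Nat.zero_le _, ht⟩
    | succ m ih =>
      intro h
      obtain ⟨t, htm, ht⟩ := ih fun j hj => h j (by omega)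
      obtain ⟨t', h0, ht'⟩ := hnext m (h m (by omega))
      exact ⟨t' + t, by omega, by rw [iterate_add_apply, ht, ht']⟩
  constructor
  · rintro ⟨t, ht⟩
    by_contra! hne
    obtain ⟨t', htt', ht'⟩ := hreach t fun j _ => hne j
    obtain ⟨d, rfl⟩ := Nat.exists_eq_add_of_le' htt'
    rw [iterate_add_apply] at ht'
    have := machine_step_iterate_nil d _ ht
    rw [ht'] at this
    exact List.cons_ne_nil _ _ this
  · intro hex
    classical
    obtain ⟨t, _, ht⟩ := hreach (Nat.find hex) fun j hj => Nat.find_min hex hj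
    have hfind : g (Nat.find hex) = 0 := Nat.find_spec hex
    refine ⟨t + 1, ?_⟩
    rw [iterate_succ_apply', ht]
    simp [CounterMachine.step, machine, s, hfind]

end WhileProgram

/-! ### Words as tuples of numbers -/

namespace WordCode

/-- The number whose binary digit of weight `2 ^ j` says whether the `j`-th letter of `w` is `a`,
with an additional leading digit of weight `2 ^ |w|`. -/
def mask {β : Type*} [DecidableEq β] (a : β) (w : List β) : ℕ :=
  w.foldr (fun b n => 2 * n + if b = a then 1 else 0) 1

theorem testBit_mask {β : Type*} [DecidableEq β] (a : β) (w : List β) (j : ℕ) :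
    (mask a w).testBit j = true ↔ j = w.length ∨ w[j]? = some a := by
  induction w generalizing j with
  | nil => simp [mask, Nat.testBit_one_eq_true_iff_self_eq_zero]
  | cons b w ih =>
    have hm : mask a (b :: w) = 2 * mask a w + if b = a then 1 else 0 := rfl
    rw [hm]
    cases j with
    | zero => by_cases h : b = a <;> simp [h, Nat.testBit_zero]
    | succ j =>
      have : (2 * mask a w + if b = a then 1 else 0) / 2 = mask a w := by split_ifs <;> omega
      rw [Nat.testBit_succ, this, ih]
      simp

theorem two_pow_length_le_mask {β : Type*} [DecidableEq β] (a : β) (w : List β) :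
    2 ^ w.length ≤ mask a w :=
  Nat.ge_two_pow_of_testBit ((testBit_mask a w _).2 (.inl rfl))

theorem eq_of_mask_eq {β : Type*} [DecidableEq β] {w w' : List β}
    (hl : w.length = w'.length) (h : ∀ a, mask a w = mask a w') : w = w' := by
  refine List.ext_getElem? fun j => ?_
  by_cases hj : j < w.length
  · have h1 := (testBit_mask w[j] w' j).1
      (h w[j] ▸ (testBit_mask w[j] w j).2 (.inr (List.getElem?_eq_getElem hj)))
    rw [List.getElem?_eq_getElem hj, h1.resolve_left (by omega)]
  · rw [List.getElem?_eq_none (by omega), List.getElem?_eq_none (by omega)]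

/-- The numbers by which a word over `Fin k` is presented to a counter machine. -/
def code {k : ℕ} (w : List (Fin k)) (a : Fin k) : ℕ := 2 * mask a w - 1

theorem mask_eq_of_code_eq {k : ℕ} {w w' : List (Fin k)} (h : code w = code w') (a : Fin k) :
    mask a w = mask a w' := by
  have h1 := congrFun h a
  have h2 := Nat.one_le_two_pow.trans (two_pow_length_le_mask a w)
  have h3 := Nat.one_le_two_pow.trans (two_pow_length_le_mask a w')
  simp only [code] at h1
  omega

/-- The leading digit reveals the length: a longer word has some letter, and the leading digit of
its mask for that letter has no counterpart in the shorter word. Over the empty alphabet there are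
no masks, but also only one word. -/
theorem code_injective {k : ℕ} : Function.Injective (code (k := k)) := by
  intro w w' h
  have hle : ∀ w w' : List (Fin k), code w = code w' → w.length ≤ w'.length := by
    intro w w' h
    by_contra! hlt
    have h1 := (testBit_mask w[w'.length] w _).2 (.inl rfl)
    rw [mask_eq_of_code_eq h, testBit_mask] at h1
    rcases h1 with h1 | h1
    · omega
    · rw [List.getElem?_eq_none hlt.le] at h1
      simp at h1
  exact eq_of_mask_eq (le_antisymm (hle _ _ h) (hle _ _ h.symm)) (mask_eq_of_code_eq h)

theorem primrec_code {α : Type*} [Primcodable α] [Finite α] {k : ℕ} (e : α ≃ Fin k) :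
    Primrec fun w : List α => List.Vector.ofFn (code (w.map e)) := by
  classical
  refine Primrec.vector_ofFn fun a => ?_
  have h : Primrec fun w : List α => w.foldr (fun b n => 2 * n + if e b = a then 1 else 0) 1 := by
    refine Primrec.list_foldr .id (.const 1) (h := fun _ p => 2 * p.2 + if e p.1 = a then 1 else 0) ?_
    have hd : Primrec fun b : α => if e b = a then 1 else 0 := Primrec.dom_finite _
    exact (Primrec.nat_add.comp (Primrec.nat_mul.comp (.const 2) (Primrec.snd.comp .snd))
      (hd.comp (Primrec.fst.comp .snd))).to₂
  refine (Primrec.nat_sub.comp (Primrec.nat_mul.comp (.const 2) h) (.const 1)).of_eq fun w => ?_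
  simp [code, mask, List.foldr_map]

-- Recursively enumerable languages as searches over codes

/-- A recursively enumerable language is the projection of a primitive recursive relation. -/
theorem exists_primrec_of_rePred {β : Type*} [Primcodable β] {p : β → Prop} (hp : REPred p) :
    ∃ g : β → ℕ → Bool, Primrec₂ g ∧ ∀ w, p w ↔ ∃ t, g w t = true := by
  obtain ⟨c, hc⟩ := Nat.Partrec.Code.exists_code.1 hp
  refine ⟨fun w t => (Nat.Partrec.Code.evaln t c (Encodable.encode w)).isSome, ?_, fun w => ?_⟩
  · exact Primrec.option_isSome.comp (Nat.Partrec.Code.primrec_evaln.comp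
      ((Primrec.snd.pair (.const c)).pair (Primrec.encode.comp .fst)))
  · have h : p w ↔ (Nat.Partrec.Code.eval c (Encodable.encode w)).Dom := by
      rw [hc]
      simp [Part.assert]
    rw [h, Part.dom_iff_mem]
    simp only [Nat.Partrec.Code.evaln_complete, Option.isSome_iff_exists]
    exact exists_comm

/-- A recursively enumerable language, given in terms of the codes of words, is the projection of
the zero set of a primitive recursive function. -/
theorem exists_primrec'_of_rePred {α : Type*} [Primcodable α] [Finite α] {k : ℕ} (e : α ≃ Fin k)
    {p : List α → Prop} (hp : REPred p) :
    ∃ f : List.Vector ℕ (k + 1) → ℕ, Nat.Primrec' f ∧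
      ∀ w, p w ↔ ∃ m, f (m ::ᵥ List.Vector.ofFn (code (w.map e))) = 0 := by
  classical
  obtain ⟨g, hg, hpg⟩ := exists_primrec_of_rePred hp
  -- Codes are never decoded: the search variable is a pair of a guessed word and a step bound, and
  -- the guess is checked by encoding it. The default `[]` is harmless, as it must pass the same
  -- check.
  let W : List.Vector ℕ (k + 1) → List α := fun v => (Encodable.decode v.head.unpair.1).getD []
  have hW : Primrec W := Primrec.option_getD.comp
    (Primrec.decode.comp (Primrec.fst.comp (Primrec.unpair.comp .vector_head))) (.const [])
  let f : List.Vector ℕ (k + 1) → ℕ := fun v =>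
    if List.Vector.ofFn (code ((W v).map e)) = v.tail ∧ g (W v) v.head.unpair.2 = true then 0 else 1
  have hf : Primrec f := by
    refine Primrec.ite (PrimrecPred.and (Primrec.eq.comp ((primrec_code e).comp hW) .vector_tail)
      (Primrec.eq.comp (hg.comp hW (Primrec.snd.comp (Primrec.unpair.comp .vector_head)))
        (.const true))) (.const 0) (.const 1)
  refine ⟨f, Nat.Primrec'.prim_iff.2 hf, fun w => ?_⟩
  rw [hpg]
  constructor
  · rintro ⟨t, ht⟩
    refine ⟨Nat.pair (Encodable.encode w) t, ?_⟩
    simp [f, W, ht]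
  · rintro ⟨m, hm⟩
    have h : List.Vector.ofFn (code ((W (m ::ᵥ List.Vector.ofFn (code (w.map e)))).map e)) =
        List.Vector.ofFn (code (w.map e)) ∧
        g (W (m ::ᵥ List.Vector.ofFn (code (w.map e)))) m.unpair.2 = true := by
      by_contra hn
      simp [f, hn] at hm
    have hc : code ((W (m ::ᵥ List.Vector.ofFn (code (w.map e)))).map e) = code (w.map e) := by
      funext a
      simpa using congrArg (fun v => List.Vector.get v a) h.1
    have := List.map_injective_iff.2 e.injective (code_injective hc)
    exact ⟨_, this ▸ h.2⟩

end WordCode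

/-! ### Derived formulas and terms -/

namespace CRASP

section Derived

variable {Γ : Type*}

def Formula.top : Formula Γ := .le (.const 0) (.const 0)

def Formula.or (φ ψ : Formula Γ) : Formula Γ := .neg (.and (.neg φ) (.neg ψ))

def Formula.eq (s t : CountTerm Γ) : Formula Γ := .and (.le s t) (.le t s)

def Formula.conj (l : List (Formula Γ)) : Formula Γ := l.foldr .and .top

def CountTerm.sum (l : List (CountTerm Γ)) : CountTerm Γ := l.foldr .add (.const 0)

variable (R : RPE) (v : List Γ) (i : ℕ)

@[simp] theorem holds_neg (φ : Formula Γ) : φ.neg.Holds R v i ↔ ¬ φ.Holds R v i := by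
  rw [Formula.Holds]

@[simp] theorem holds_and (φ ψ : Formula Γ) :
    (φ.and ψ).Holds R v i ↔ φ.Holds R v i ∧ ψ.Holds R v i := by
  rw [Formula.Holds]

@[simp] theorem holds_le (s t : CountTerm Γ) :
    (Formula.le s t).Holds R v i ↔ s.val R v i ≤ t.val R v i := by
  rw [Formula.Holds]

@[simp] theorem val_const (c : ℤ) : (CountTerm.const c : CountTerm Γ).val R v i = c := by
  rw [CountTerm.val]

@[simp] theorem val_smul (c : ℤ) (t : CountTerm Γ) :
    (t.smul c).val R v i = c * t.val R v i := by
  rw [CountTerm.val]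

@[simp] theorem val_add (s t : CountTerm Γ) :
    (s.add t).val R v i = s.val R v i + t.val R v i := by
  rw [CountTerm.val]

@[simp] theorem holds_top : (Formula.top : Formula Γ).Holds R v i := by
  simp [Formula.top]

@[simp] theorem holds_or (φ ψ : Formula Γ) :
    (φ.or ψ).Holds R v i ↔ φ.Holds R v i ∨ ψ.Holds R v i := by
  simp only [Formula.or, holds_neg, holds_and]
  tauto

@[simp] theorem holds_eq (s t : CountTerm Γ) :
    (Formula.eq s t).Holds R v i ↔ s.val R v i = t.val R v i := by
  simp [Formula.eq, le_antisymm_iff]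

@[simp] theorem holds_conj (l : List (Formula Γ)) :
    (Formula.conj l).Holds R v i ↔ ∀ φ ∈ l, φ.Holds R v i := by
  induction l with
  | nil => simp [Formula.conj]
  | cons φ l ih =>
    have : Formula.conj (φ :: l) = φ.and (Formula.conj l) := rfl
    simp [this, ih]

@[simp] theorem val_sum (l : List (CountTerm Γ)) :
    (CountTerm.sum l).val R v i = (l.map fun t => t.val R v i).sum := by
  induction l with
  | nil => simp [CountTerm.sum]
  | cons t l ih =>
    have : CountTerm.sum (t :: l) = t.add (CountTerm.sum l) := rfl
    simp [this, ih]

/-- A count is the cardinality of each finite set that consists of the counted positions. -/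
theorem val_count {φ : Formula Γ} {S : Finset ℕ}
    (hS : ∀ j, j ∈ S ↔ (1 ≤ j ∧ j ≤ i) ∧ φ.Holds R v j) :
    (CountTerm.count φ).val R v i = S.card := by
  rw [CountTerm.val]
  congr 2
  ext j
  simp [hS]

theorem val_countRPE {φ : Formula Γ} {S : Finset ℕ}
    (hS : ∀ j, j ∈ S ↔ (1 ≤ j ∧ j ≤ i) ∧ (i, j) ∈ R ∧ φ.Holds R v j) :
    (CountTerm.countRPE φ).val R v i = S.card := by
  rw [CountTerm.val]
  congr 2
  ext j
  simp [hS]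

theorem one_le_val_count (φ : Formula Γ) :
    1 ≤ (CountTerm.count φ).val R v i ↔ ∃ j, (1 ≤ j ∧ j ≤ i) ∧ φ.Holds R v j := by
  classical
  rw [val_count R v i (φ := φ) (S := (Finset.Icc 1 i).filter fun j => φ.Holds R v j) (by simp)]
  rw [Nat.one_le_cast, Nat.one_le_iff_ne_zero, Finset.card_ne_zero]
  simp [Finset.Nonempty]

theorem holds_letter_map_range (g : ℕ → Γ) (N : ℕ) (a : Γ) :
    (Formula.letter a).Holds R ((List.range N).map g) i ↔ 1 ≤ i ∧ i ≤ N ∧ g (i - 1) = a := by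
  rw [Formula.Holds]
  by_cases h : i - 1 < N
  · simp only [List.getElem?_map, List.getElem?_range h, Option.map_some, Option.some.injEq]
    constructor
    · exact fun ⟨h1, h2⟩ => ⟨h1, by omega, h2⟩
    · exact fun ⟨h1, _, h2⟩ => ⟨h1, h2⟩
  · rw [List.getElem?_eq_none (by simpa using h)]
    simp
    omega

/-- A rule whose formula holds determines the output if all applicable rules output the same
token. -/
theorem CoT.next_eq_some {P : CoT Γ} {R : RPE} {v : List Γ} {a : Γ}
    (h : ∃ r ∈ P.rules, r.2.Holds R v v.length)
    (h' : ∀ r ∈ P.rules, r.2.Holds R v v.length → r.1 = a) : P.next R v = some a := by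
  classical
  obtain ⟨r, hr, hrh⟩ := h
  rw [CoT.next]
  cases hf : P.rules.find? fun r => decide (r.2.Holds R v v.length) with
  | none =>
    rw [List.find?_eq_none] at hf
    exact absurd hrh (by simpa using hf r hr)
  | some r' =>
    have h1 := List.mem_of_find?_eq_some hf
    have h2 := List.find?_some hf
    simp [h' r' h1 (by simpa using h2)]

/-- The chain of thought is deterministic, so a sequence `g` that obeys the output rule at every
prefix from length `l` on is the whole chain. -/
theorem CoT.accepts_iff_of_next {P : CoT Γ} {R : RPE} {g : ℕ → Γ} {l : ℕ}
    (h : ∀ n, P.next R ((List.range (l + n)).map g) = some (g (l + n))) :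
    P.Accepts R ((List.range l).map g) ↔ ∃ n, g (l + n) ∈ P.accept := by
  have hrun : ∀ n, P.run R ((List.range l).map g) n = some ((List.range (l + n)).map g) := by
    intro n
    induction n with
    | zero => rfl
    | succ n ih => simp [CoT.run, ih, h, ← Nat.add_assoc, List.range_succ]
  constructor
  · rintro ⟨n, u, a, hu, ha, hacc⟩
    rw [hrun, Option.some.injEq] at hu
    subst hu
    rw [h, Option.some.injEq] at ha
    exact ⟨n, ha ▸ hacc⟩
  · rintro ⟨n, hn⟩
    exact ⟨n, _, _, hrun n, h n, hn⟩

end Derived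

/-! ### Reading the input word -/

/-- The tokens of the simulation of a counter machine with the set of states `Q` on input words over
`Fin k`: the input is followed by one `mark`, then by `pad`s, and then by a run of the machine. -/
inductive Token (k : ℕ) (Q : Type) where
  | input (a : Fin k) : Token k Q
  | mark : Token k Q
  | pad : Token k Q
  | state (q : Q) : Token k Q

section Simulation

variable {k : ℕ} {Q : Type}

instance [Finite Q] : Finite (Token k Q) := by
  refine Finite.of_surjective
    (fun x : (Fin k ⊕ Bool) ⊕ Q => match x with
      | .inl (.inl a) => Token.input a
      | .inl (.inr true) => Token.mark
      | .inl (.inr false) => Token.pad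
      | .inr q => Token.state q) ?_
  rintro (a | _ | _ | q)
  exacts [⟨.inl (.inl a), rfl⟩, ⟨.inl (.inr true), rfl⟩, ⟨.inl (.inr false), rfl⟩, ⟨.inr q, rfl⟩]

/-- The binary digits of positive weight of the current position are those at the occurrences of
`a` and at the mark. -/
def meetsMask (a : Fin k) : Formula (Token k Q) :=
  .and (.eq (.countRPE (.letter .mark)) (.const 1))
    (.and (.eq (.countRPE (.letter (.input a))) (.count (.letter (.input a))))
      (.eq (.countRPE .top) (.add (.countRPE (.letter (.input a))) (.const 1))))

/-- All masks have been met. -/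
def ready : Formula (Token k Q) :=
  .conj ((List.finRange k).map fun a => .le (.const 1) (.count (meetsMask a)))

/-- The number of positions before the mask of `a` is met. -/
def inputTerm (a : Fin k) : CountTerm (Token k Q) :=
  .count (.neg (.le (.const 1) (.count (meetsMask a))))

open WordCode

variable {w : List (Fin k)} {g : ℕ → Token k Q} {N : ℕ}

/-- With `U` the set digits of positive weight and `A` the positions of `a`, the equations say that
`U` contains the mark, contains `A`, and has just one more element than `A`. Hence `U` is `A`
together with the mark. -/
theorem holds_meetsMask (hin : ∀ j a, g j = .input a ↔ w[j]? = some a)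
    (hmark : ∀ j, g j = .mark ↔ j = w.length) (a : Fin k) {i : ℕ} (hi : i ≤ N) :
    (meetsMask a).Holds bitRPE ((List.range N).map g) i ↔ i / 2 = mask a w := by
  classical
  let U : Finset ℕ := (Finset.Icc 1 i).filter fun j => i.testBit j = true
  let A : Finset ℕ := (Finset.Icc 1 i).filter fun j => w[j - 1]? = some a
  have hU : ∀ j, j ∈ U ↔ (1 ≤ j ∧ j ≤ i) ∧ i.testBit j = true := by simp [U]
  have hA : ∀ j, j ∈ A ↔ (1 ≤ j ∧ j ≤ i) ∧ w[j - 1]? = some a := by simp [A]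
  have hbit : ∀ j, (i, j) ∈ bitRPE ↔ i.testBit j = true := fun j => Iff.rfl
  have e1 := val_countRPE bitRPE ((List.range N).map g) i (φ := .letter .mark)
    (S := U.filter fun j => j = w.length + 1) fun j => by
      simp only [Finset.mem_filter, hU, hbit, holds_letter_map_range, hmark]
      constructor
      · exact fun h => ⟨h.1.1, h.1.2, h.1.1.1, by omega, by omega⟩
      · exact fun h => ⟨⟨h.1, h.2.1⟩, by omega⟩
  have e2 := val_countRPE bitRPE ((List.range N).map g) i (φ := .letter (.input a))
    (S := U ∩ A) fun j => by
      simp only [Finset.mem_inter, hU, hA, hbit, holds_letter_map_range, hin]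
      constructor
      · exact fun h => ⟨h.1.1, h.1.2, h.1.1.1, by omega, h.2.2⟩
      · exact fun h => ⟨⟨h.1, h.2.1⟩, h.1, h.2.2.2.2⟩
  have e3 := val_count bitRPE ((List.range N).map g) i (φ := .letter (.input a))
    (S := A) fun j => by
      simp only [hA, holds_letter_map_range, hin]
      constructor
      · exact fun h => ⟨h.1, h.1.1, by omega, h.2⟩
      · exact fun h => ⟨h.1, h.2.2.2⟩
  have e4 := val_countRPE bitRPE ((List.range N).map g) i (φ := .top) (S := U) fun j => by
      simp only [hU, hbit, holds_top, and_true]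
  simp only [meetsMask, holds_and, holds_eq, e1, e2, e3, e4, val_const, val_add]
  norm_cast
  have hmaskbit : i / 2 = mask a w ↔
      ∀ j, i.testBit (j + 1) = true ↔ j = w.length ∨ w[j]? = some a := by
    refine ⟨fun h j => by rw [Nat.testBit_succ, h, testBit_mask], fun h => ?_⟩
    refine Nat.eq_of_testBit_eq fun j => ?_
    rw [Bool.eq_iff_iff, ← Nat.testBit_succ, h, testBit_mask]
  have hlt : ∀ j, i.testBit j = true → j ≤ i := fun j h =>
    (Nat.lt_two_pow_self.trans_le (Nat.ge_two_pow_of_testBit h)).le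
  have hnone : ∀ j, w.length ≤ j → w[j]? ≠ some a := fun j h => by
    rw [List.getElem?_eq_none h]
    exact (Option.some_ne_none a).symm
  rw [hmaskbit]
  constructor
  · rintro ⟨h1, h2, h3⟩
    obtain ⟨j₀, hj₀⟩ := Finset.card_eq_one.1 h1
    -- This also puts `i` beyond the input, so that `A` contains every occurrence of `a`.
    have hm : w.length + 1 ∈ U := by
      have : j₀ ∈ U.filter fun j => j = w.length + 1 := by simp [hj₀]
      obtain ⟨h4, rfl⟩ := Finset.mem_filter.1 this
      exact h4
    have hAU : U ∩ A = A := Finset.eq_of_subset_of_card_le Finset.inter_subset_right h2.ge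
    have hnot : w.length + 1 ∉ A := by simp [hA]
    have hUA : insert (w.length + 1) A = U := by
      refine Finset.eq_of_subset_of_card_le (Finset.insert_subset hm ?_) ?_
      · exact hAU ▸ Finset.inter_subset_left
      · rw [Finset.card_insert_of_notMem hnot, h3, hAU]
    intro j
    have hj : i.testBit (j + 1) = true ↔ j + 1 ∈ U := by
      rw [hU]
      exact ⟨fun h => ⟨⟨by omega, hlt _ h⟩, h⟩, fun h => h.2⟩
    rw [hj, ← hUA, Finset.mem_insert, hA]
    have h5 := ((hU _).1 hm).1.2
    constructor
    · exact Or.imp (by omega) (by simp)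
    · refine Or.imp (by omega) fun h => ⟨⟨by omega, ?_⟩, h⟩
      by_contra hlt'
      exact hnone j (by omega) h
  · intro h
    have hm : w.length + 1 ∈ U := (hU _).2
      ⟨⟨by omega, hlt _ ((h _).2 (.inl rfl))⟩, (h _).2 (.inl rfl)⟩
    have hAU : U ∩ A = A := by
      refine Finset.inter_eq_right.2 fun j hj => ?_
      obtain ⟨h1, h2⟩ := (hA j).1 hj
      have := (h (j - 1)).2 (.inr h2)
      rw [Nat.sub_add_cancel h1.1] at this
      exact (hU j).2 ⟨h1, this⟩
    refine ⟨Finset.card_eq_one.2 ⟨w.length + 1, ?_⟩, by rw [hAU], ?_⟩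
    · ext j
      simp only [Finset.mem_filter, Finset.mem_singleton]
      exact ⟨fun h => h.2, fun h => ⟨h ▸ hm, h⟩⟩
    · have hnot : w.length + 1 ∉ A := by simp [hA]
      rw [hAU, ← Finset.card_insert_of_notMem hnot]
      congr 1
      ext j
      rw [Finset.mem_insert, hU, hA]
      constructor
      · rintro ⟨h1, h2⟩
        have := (h (j - 1)).1 (by rwa [Nat.sub_add_cancel h1.1])
        exact this.imp (by omega) fun h3 => ⟨h1, h3⟩
      · rintro (rfl | ⟨h1, h2⟩)
        · exact (hU _).1 hm
        · have := (h (j - 1)).2 (.inr h2)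
          rw [Nat.sub_add_cancel h1.1] at this
          exact ⟨h1, this⟩

theorem one_le_count_meetsMask (hin : ∀ j a, g j = .input a ↔ w[j]? = some a)
    (hmark : ∀ j, g j = .mark ↔ j = w.length) (a : Fin k) {i : ℕ} (hi : i ≤ N) :
    1 ≤ (CountTerm.count (meetsMask a)).val bitRPE ((List.range N).map g) i ↔
      2 * mask a w ≤ i := by
  have hpos := Nat.one_le_two_pow.trans (two_pow_length_le_mask a w)
  rw [one_le_val_count]
  constructor
  · rintro ⟨j, hj, h⟩
    rw [holds_meetsMask hin hmark a (by omega)] at h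
    omega
  · intro h
    exact ⟨2 * mask a w, ⟨by omega, h⟩, by rw [holds_meetsMask hin hmark a (by omega)]; omega⟩

theorem holds_ready (hin : ∀ j a, g j = .input a ↔ w[j]? = some a)
    (hmark : ∀ j, g j = .mark ↔ j = w.length) :
    ready.Holds bitRPE ((List.range N).map g) N ↔ ∀ a, 2 * mask a w ≤ N := by
  simp [ready, one_le_count_meetsMask hin hmark _ le_rfl]

/-- The mask is first met at `2 * mask a w`, the smaller of the two solutions of `i / 2 = mask a w`,
and the counted condition fails from there on. -/
theorem val_inputTerm (hin : ∀ j a, g j = .input a ↔ w[j]? = some a)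
    (hmark : ∀ j, g j = .mark ↔ j = w.length) (a : Fin k) (hN : 2 * mask a w ≤ N) :
    (inputTerm a).val bitRPE ((List.range N).map g) N = code w a := by
  have hpos := Nat.one_le_two_pow.trans (two_pow_length_le_mask a w)
  rw [inputTerm, val_count (S := Finset.Icc 1 (2 * mask a w - 1)), Nat.card_Icc, code]
  · simp
  · intro j
    simp only [Finset.mem_Icc, holds_neg, holds_le, val_const]
    constructor
    · intro h
      rw [one_le_count_meetsMask hin hmark a (by omega)]
      omega
    · rintro ⟨h1, h2⟩
      rw [one_le_count_meetsMask hin hmark a h1.2] at h2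
      omega

end Simulation

end CRASP

/-! ### Simulation of counter machines -/

namespace CRASP

section Simulation

open WordCode

variable {k : ℕ} {Q : Type}

/-- The change of the counter `r` that a token stands for. -/
def Token.effect (M : CounterMachine Q) (r : ℕ) : Token k Q → ℤ
  | .state q => M.effect q r
  | _ => 0

/-- The value of the counter `r`. -/
noncomputable def counterTerm [Fintype Q] (M : CounterMachine Q) (r : ℕ) :
    CountTerm (Token k Q) :=
  .add (if h : r < k then inputTerm ⟨r, h⟩ else .const 0)
    (.sum ((Finset.univ : Finset Q).toList.map fun q =>
      .smul (M.effect q r) (.count (.letter (.state q)))))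

theorem sum_effect_mul_count [Fintype Q] (M : CounterMachine Q) (r : ℕ) (g : ℕ → Token k Q)
    (N : ℕ) :
    ∑ q, M.effect q r * (CountTerm.count (.letter (.state q))).val bitRPE
      ((List.range N).map g) N = ∑ j ∈ Finset.range N, (g j).effect M r := by
  classical
  have h : ∀ q, (CountTerm.count (.letter (.state q))).val bitRPE ((List.range N).map g) N =
      ∑ j ∈ Finset.range N, if g j = .state q then (1 : ℤ) else 0 := by
    intro q
    rw [val_count (S := ((Finset.range N).filter fun j => g j = .state q).map
      (addRightEmbedding 1)), Finset.card_map, Finset.natCast_card_filter]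
    intro j
    simp only [Finset.mem_map, Finset.mem_filter, Finset.mem_range, addRightEmbedding_apply,
      holds_letter_map_range]
    constructor
    · rintro ⟨j, ⟨h1, h2⟩, rfl⟩
      exact ⟨by omega, by omega, by omega, h2⟩
    · rintro ⟨h1, h2, h3, h4⟩
      exact ⟨j - 1, ⟨by omega, h4⟩, by omega⟩
  simp only [h, Finset.mul_sum]
  rw [Finset.sum_comm]
  refine Finset.sum_congr rfl fun j _ => ?_
  cases hj : g j <;> simp [Token.effect]

theorem step_iterate_snd (M : CounterMachine Q) (x : Q × (ℕ → ℤ)) (t r : ℕ) :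
    (M.step^[t] x).2 r = x.2 r + ∑ j ∈ Finset.range t, M.effect (M.step^[j] x).1 r := by
  induction t with
  | zero => simp
  | succ t ih =>
    rw [Function.iterate_succ_apply', Finset.sum_range_succ, ← add_assoc, ← ih]
    rfl

/-- The chain of thought that simulates a counter machine. -/
noncomputable def simulation (k : ℕ) [Fintype Q] (M : CounterMachine Q) (start halt : Q) :
    CoT (Token k Q) where
  rules :=
    [(.mark, .neg (.le (.const 1) (.count (.letter .mark)))),
      (.pad, .and (.or (.letter .mark) (.letter .pad)) (.neg ready)),
      (.state start, .and (.or (.letter .mark) (.letter .pad)) ready)] ++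
    (Finset.univ : Finset Q).toList.flatMap fun q =>
      [(.state (M.onZero q), .and (.letter (.state q))
          (.le (counterTerm M (M.test q)) (.const 0))),
        (.state (M.onPos q), .and (.letter (.state q))
          (.neg (.le (counterTerm M (M.test q)) (.const 0))))]
  accept := {.state halt}

/-- The intended chain is written down as one infinite sequence `g`; at each of its prefixes from
the input on, exactly the intended token is offered by the applicable rules, so their order plays no
role. -/
theorem simulation_accepts_iff [Fintype Q] (M : CounterMachine Q) (start halt : Q)
    (w : List (Fin k)) :
    (simulation k M start halt).Accepts bitRPE (w.map .input) ↔
      ∃ t, (M.step^[t] (start, fun r => (CounterMachine.initial (code w) r : ℤ))).1 = halt := by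
  classical
  set x₀ : Q × (ℕ → ℤ) := (start, fun r => (CounterMachine.initial (code w) r : ℤ)) with hx₀
  let B : ℕ := Finset.univ.sup fun a => 2 * mask a w
  -- Offset of the first state token, counted from the mark at offset `0`. The maximum matters only
  -- for the empty alphabet, where `B = 0`.
  let n₀ : ℕ := max 1 (B - w.length)
  have hn₀ : 1 ≤ n₀ := le_max_left _ _
  have hB : ∀ n ≥ 1, (∀ a, 2 * mask a w ≤ w.length + n) ↔ n₀ ≤ n := by
    intro n hn
    have : (∀ a, 2 * mask a w ≤ w.length + n) ↔ B ≤ w.length + n := by simp [B]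
    rw [this]
    simp only [n₀]
    omega
  let tok : ℕ → Token k Q := fun n =>
    if n = 0 then .mark else if n < n₀ then .pad else .state (M.step^[n - n₀] x₀).1
  let g : ℕ → Token k Q := fun j => if h : j < w.length then .input w[j] else tok (j - w.length)
  have hg : ∀ n, g (w.length + n) = tok n := by simp [g]
  have tok_zero : tok 0 = .mark := rfl
  have tok_pad : ∀ n, 1 ≤ n → n < n₀ → tok n = .pad := fun n h1 h2 => by
    simp only [tok]
    rw [if_neg (by omega), if_pos h2]
  have tok_state : ∀ t, tok (n₀ + t) = .state (M.step^[t] x₀).1 := fun t => by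
    simp only [tok]
    rw [if_neg (by omega), if_neg (by omega), Nat.add_sub_cancel_left]
  have hcases : ∀ n, n = 0 ∨ (1 ≤ n ∧ n < n₀) ∨ ∃ t, n = n₀ + t := by
    intro n
    by_cases h : n < n₀
    · omega
    · exact .inr (.inr ⟨n - n₀, by omega⟩)
  have tok_ne_input : ∀ n a, tok n ≠ .input a := by
    intro n a
    rcases hcases n with rfl | h | ⟨t, rfl⟩
    · simp [tok_zero]
    · simp [tok_pad n h.1 h.2]
    · simp [tok_state]
  have tok_eq_mark : ∀ n, tok n = .mark ↔ n = 0 := by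
    intro n
    rcases hcases n with rfl | h | ⟨t, rfl⟩
    · simp [tok_zero]
    · simp only [tok_pad n h.1 h.2, reduceCtorEq, false_iff]
      omega
    · simp only [tok_state, reduceCtorEq, false_iff]
      omega
  have hin : ∀ j a, g j = .input a ↔ w[j]? = some a := by
    intro j a
    by_cases h : j < w.length
    · simp [g, h]
    · simp [g, h, tok_ne_input]
  have hmark : ∀ j, g j = .mark ↔ j = w.length := by
    intro j
    by_cases h : j < w.length
    · simp [g, h, h.ne]
    · simp only [g, h, dif_neg, not_false_eq_true, tok_eq_mark]
      omega
  have hinput : w.map .input = (List.range w.length).map g := by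
    refine List.ext_getElem (by simp) fun j h1 h2 => ?_
    have hj : j < w.length := by simpa using h1
    simp [g, hj]
  -- The token of the state at time `t` is already counted, hence `t + 1`. This is why the machine
  -- adds the effect before it tests.
  have hval : ∀ t r, (counterTerm M r).val bitRPE ((List.range (w.length + (n₀ + t + 1))).map g)
      (w.length + (n₀ + t + 1)) = (M.step^[t + 1] x₀).2 r := by
    intro t r
    have hb := (hB (n₀ + t + 1) (by omega)).2 (by omega)
    rw [counterTerm, val_add, val_sum, List.map_map, step_iterate_snd]
    congr 1
    · simp only [hx₀, CounterMachine.initial]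
      split_ifs with h
      · exact val_inputTerm hin hmark _ (hb _)
      · simp
    · have := sum_effect_mul_count M r g (w.length + (n₀ + t + 1))
      rw [Finset.sum_map_toList]
      simp only [Function.comp_def, val_smul, this]
      rw [show w.length + (n₀ + t + 1) = w.length + n₀ + (t + 1) by omega,
        Finset.sum_range_add, Finset.sum_eq_zero, zero_add]
      · refine Finset.sum_congr rfl fun j _ => ?_
        rw [Nat.add_assoc, hg, tok_state]
        rfl
      · intro j hj
        rw [Finset.mem_range] at hj
        by_cases h : j < w.length
        · simp [g, h, Token.effect]
        · obtain ⟨n, rfl⟩ := Nat.exists_eq_add_of_le (not_lt.1 h)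
          rw [hg]
          rcases hcases n with rfl | h | ⟨t, rfl⟩
          · rfl
          · rw [tok_pad n h.1 h.2]; rfl
          · omega
  have hone : ∀ n, 1 ≤ (CountTerm.count (.letter .mark)).val bitRPE
      ((List.range (w.length + n)).map g) (w.length + n) ↔ 1 ≤ n := by
    intro n
    rw [one_le_val_count]
    simp only [holds_letter_map_range, hmark]
    constructor
    · rintro ⟨j, h1, h2⟩
      omega
    · intro h
      exact ⟨w.length + 1, by omega, by omega, by omega, by omega⟩
  have hlast : ∀ n b, (Formula.letter b).Holds bitRPE ((List.range (w.length + (n + 1))).map g)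
      (w.length + (n + 1)) ↔ tok n = b := by
    intro n b
    rw [holds_letter_map_range, ← hg, ← Nat.add_assoc, Nat.add_sub_cancel]
    exact ⟨fun h => h.2.2, fun h => ⟨by omega, le_rfl, h⟩⟩
  -- Right after the input the last token is an input letter, or there is none if `w` is empty;
  -- either way only the mark rule applies.
  have hlast0 : ∀ b : Token k Q, (∀ a, b ≠ .input a) → ¬ (Formula.letter b).Holds bitRPE
      ((List.range (w.length + 0)).map g) (w.length + 0) := by
    intro b hb
    rw [holds_letter_map_range]
    rintro ⟨h1, h2, h3⟩
    have h4 : w.length + 0 - 1 < w.length := by omega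
    simp only [g, h4, dif_pos] at h3
    exact hb _ h3.symm
  have hready : ∀ n ≥ 1, ready.Holds bitRPE ((List.range (w.length + n)).map g)
      (w.length + n) ↔ n₀ ≤ n := fun n hn => by
    rw [holds_ready hin hmark, hB n hn]
  have hbefore : ∀ n, ((Formula.letter .mark).or (.letter .pad)).Holds bitRPE
      ((List.range (w.length + (n + 1))).map g) (w.length + (n + 1)) ↔ n < n₀ := by
    intro n
    rw [holds_or, hlast, hlast]
    rcases hcases n with rfl | h | ⟨t, rfl⟩
    · simp [tok_zero]
      omega
    · simp [tok_pad n h.1 h.2, h.2]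
    · simp [tok_state]
  have hstate : ∀ n q, (Formula.letter (.state q)).Holds bitRPE
      ((List.range (w.length + (n + 1))).map g) (w.length + (n + 1)) ↔
        ∃ t, n = n₀ + t ∧ q = (M.step^[t] x₀).1 := by
    intro n q
    rw [hlast]
    rcases hcases n with rfl | h | ⟨t, rfl⟩
    · simp only [tok_zero, reduceCtorEq, false_iff]
      rintro ⟨t, h, _⟩
      omega
    · simp only [tok_pad n h.1 h.2, reduceCtorEq, false_iff]
      rintro ⟨t, h', _⟩
      omega
    · simp [tok_state, eq_comm]
  have hfst : ∀ t, (M.step^[t + 1] x₀).1 =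
      if (M.step^[t + 1] x₀).2 (M.test (M.step^[t] x₀).1) ≤ 0 then M.onZero (M.step^[t] x₀).1
      else M.onPos (M.step^[t] x₀).1 := by
    intro t
    rw [Function.iterate_succ_apply']
    rfl
  have tok_start : tok n₀ = .state start := tok_state 0
  have hnext : ∀ n, (simulation k M start halt).next bitRPE
      ((List.range (w.length + n)).map g) = some (g (w.length + n)) := by
    intro n
    rw [hg]
    refine CoT.next_eq_some ?_ ?_
    · simp only [simulation, List.length_map, List.length_range, List.mem_append, List.mem_cons,
        List.not_mem_nil, List.mem_flatMap, Finset.mem_toList, Finset.mem_univ, true_and, or_false]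
      rcases n with _ | n
      · refine ⟨_, .inl (.inl rfl), ?_⟩
        rw [holds_neg, holds_le, val_const, hone]
        omega
      · by_cases hn : n < n₀
        · by_cases hn' : n + 1 < n₀
          · refine ⟨_, .inl (.inr (.inl rfl)), ?_⟩
            rw [holds_and, holds_neg, hbefore, hready _ (by omega)]
            omega
          · refine ⟨_, .inl (.inr (.inr rfl)), ?_⟩
            rw [holds_and, hbefore, hready _ (by omega)]
            omega
        · obtain ⟨t, rfl⟩ := Nat.exists_eq_add_of_le (not_lt.1 hn)
          by_cases hz : (M.step^[t + 1] x₀).2 (M.test (M.step^[t] x₀).1) ≤ 0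
          · refine ⟨_, .inr ⟨(M.step^[t] x₀).1, .inl rfl⟩, ?_⟩
            rw [holds_and, hstate, holds_le, hval, val_const]
            exact ⟨⟨t, rfl, rfl⟩, hz⟩
          · refine ⟨_, .inr ⟨(M.step^[t] x₀).1, .inr rfl⟩, ?_⟩
            rw [holds_and, hstate, holds_neg, holds_le, hval, val_const]
            exact ⟨⟨t, rfl, rfl⟩, hz⟩
    · simp only [simulation, List.length_map, List.length_range, List.mem_append, List.mem_cons,
        List.not_mem_nil, List.mem_flatMap, Finset.mem_toList, Finset.mem_univ, true_and, or_false]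
      rcases n with _ | n
      · rintro r ((rfl | rfl | rfl) | ⟨q, rfl | rfl⟩) hr
        · rfl
        · rw [holds_and, holds_or] at hr
          exact absurd hr.1 (not_or.2 ⟨hlast0 _ (by simp), hlast0 _ (by simp)⟩)
        · rw [holds_and, holds_or] at hr
          exact absurd hr.1 (not_or.2 ⟨hlast0 _ (by simp), hlast0 _ (by simp)⟩)
        · rw [holds_and] at hr
          exact absurd hr.1 (hlast0 _ (by simp))
        · rw [holds_and] at hr
          exact absurd hr.1 (hlast0 _ (by simp))
      · rintro r ((rfl | rfl | rfl) | ⟨q, rfl | rfl⟩) hr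
        · rw [holds_neg, holds_le, val_const, hone] at hr
          omega
        · rw [holds_and, holds_neg, hbefore, hready _ (by omega)] at hr
          exact (tok_pad _ (by omega) (by omega)).symm
        · rw [holds_and, hbefore, hready _ (by omega)] at hr
          rw [show n + 1 = n₀ by omega, tok_start]
        · rw [holds_and, hstate] at hr
          obtain ⟨⟨t, rfl, rfl⟩, hz⟩ := hr
          rw [holds_le, hval, val_const] at hz
          rw [Nat.add_assoc, tok_state, hfst, if_pos hz]
        · rw [holds_and, hstate] at hr
          obtain ⟨⟨t, rfl, rfl⟩, hz⟩ := hr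
          rw [holds_neg, holds_le, hval, val_const] at hz
          rw [Nat.add_assoc, tok_state, hfst, if_neg hz]
  rw [hinput, CoT.accepts_iff_of_next hnext]
  simp only [hg, simulation, Set.mem_singleton_iff]
  constructor
  · rintro ⟨n, hn⟩
    rcases hcases n with rfl | h | ⟨t, rfl⟩
    · simp [tok_zero] at hn
    · simp [tok_pad n h.1 h.2] at hn
    · exact ⟨t, by simpa [tok_state] using hn⟩
  · rintro ⟨t, ht⟩
    exact ⟨n₀ + t, by rw [tok_state, ht]⟩

end Simulation

end CRASP

-- Assembling the main theorem

theorem mainTheorem3 {α : Type*} [Finite α] [Primcodable α]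
    (L : Language α) (hL : REPred fun w : List α => w ∈ L) :
    ∃ (Γ : Type) (_ : Finite Γ) (emb : α ↪ Γ) (P : CRASP.CoT Γ),
      P.Recognizes CRASP.bitRPE emb L := by
  obtain ⟨k, ⟨e⟩⟩ := Finite.exists_equiv_fin α
  obtain ⟨f, hf, hfL⟩ := WordCode.exists_primrec'_of_rePred e hL
  obtain ⟨Q, _, M, start, halt, hM⟩ := WhileProgram.exists_counterMachine hf
  have := Fintype.ofFinite Q
  refine ⟨CRASP.Token k Q, inferInstance, ⟨fun a => .input (e a), fun a b h => by simpa using h⟩,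
    CRASP.simulation k M start halt, fun w => ?_⟩
  have h : w.map (fun a => CRASP.Token.input (Q := Q) (e a)) = (w.map e).map .input := by simp
  rw [hfL, ← hM, ← CRASP.simulation_accepts_iff, ← h]
  rfl
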